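/- Let $\phi:\mathbb T\to\mathbb T$, $\mathbb T=\mathbb R/\mathbb Z$, be an irrational rotation, $\phi(x)=x+\alpha$ with $\alpha\in\mathbb R\setminus\mathbb Q$. There is a continuous function $F:\mathbb T\to\mathbb R$ such that 1. for every $\beta\in\mathbb R$ there is an $e^{\beta F}$-conformal measure; 2. for every $\beta\ge 0$ there is exactly one ergodic $e^{\beta F}$-conformal measure of type $II_1$; 3. for every $\beta<0$ every ergodic $e^{\beta F}$-conformal measure is of type $II_\infty$ or of type $III$. Here the following definitions are used. An *$e^{\beta F}$-conformal measure* is a Borel probability measure $m$ on $\mathbb T$ with $m(\phi(B))=\int_B e^{\beta F}\,\mathrm dm$ for all Borel sets $B$; it is *ergodic* if $m(B)\in\{0,1\}$ for every Borel set $B$ with $\phi^{-1}(B)=B$. Put $S_k=\sum_{j=0}^{k-1}F\circ\phi^j$ for $k\ge 0$ and $S_{k}=-\sum_{j=1}^{|k|}F\circ\phi^{-j}$ for $k<0$, and for fixed $\beta$ let - $M_{I}$ be the set of points $x$ with $\sum_{n\in\mathbb Z}e^{\beta S_n(x)}<\infty$, together with all $x$ that are $\phi$-periodic, of minimal period $p\ge1$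 say, with $S_p(x)=0$ (there are no periodic points for an irrational rotation); - $M_{II_1}=\{x:\ \liminf_{n}\frac1n\sum_{j=1}^n e^{\beta S_j(x)}>0\}\setminus M_I$, the lower limit being taken in $[0,\infty]$; - $M_{III}$ be a $\phi$-invariant Borel set such that there is a Borel function $u:\mathbb T\setminus M_{III}\to\mathbb R$ with $\beta F=u\circ\phi-u$ on $\mathbb T\setminus M_{III}$, while $m(A)=0$ for every $\phi$-invariant Borel set $A\subseteq M_{III}$ on which there is a Borel function $u:A\to\mathbb R$ with $\beta F=u\circ\phi-u$ (such a set exists for every $e^{\beta F}$-conformal measure $m$ and is unique up to $m$-null sets); - $M_{II_\infty}=\mathbb T\setminus(M_I\cup M_{II_1}\cup M_{III})$. For $t\in\{II_1,II_\infty,III\}$, the measure $m$ is *of type $t$* if $m(M_t)=1$. -/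

import Mathlib

open MeasureTheory Filter Set

namespace CrossedFlow

noncomputable section

variable {X : Type*} [TopologicalSpace X]

/-- The two-sided Birkhoff sums of a potential `F` along a homeomorphism `φ`:
`S_k(F) = ∑_{j=0}^{k-1} F ∘ φ^j` for `k ≥ 0` and `S_k(F) = -∑_{j=1}^{|k|} F ∘ φ^{-j}` for `k < 0`
(the integer `Int.negSucc n` is `-(n+1)`). -/
def orbitSum (φ : X ≃ₜ X) (F : X → ℝ) : ℤ → X → ℝ
  | Int.ofNat n, x => ∑ j ∈ Finset.range n, F (φ^[j] x)
  | Int.negSucc n, x => -∑ j ∈ Finset.Icc 1 (n + 1), F (φ.symm^[j] x)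

/-- The set `M_{I_p}` (used for `p ≥ 1`): points of minimal period `p` over whose orbit `F` sums
to zero. -/
def typeIpSet (φ : X ≃ₜ X) (F : X → ℝ) (p : ℕ) : Set X :=
  {x | φ^[p] x = x ∧ (∀ j, 1 ≤ j → j < p → φ^[j] x ≠ x) ∧ orbitSum φ F p x = 0}

/-- The set `M_{I_∞}`: points with `∑_{n ∈ ℤ} e^{β S_n(F)(x)} < ∞`. -/
def typeIInftySet (φ : X ≃ₜ X) (F : X → ℝ) (β : ℝ) : Set X :=
  {x | Summable fun n : ℤ => Real.exp (β * orbitSum φ F n x)}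

/-- The set `M_I = M_{I_∞} ∪ ⋃_{p ≥ 1} M_{I_p}`. -/
def typeISet (φ : X ≃ₜ X) (F : X → ℝ) (β : ℝ) : Set X :=
  typeIInftySet φ F β ∪ ⋃ p : ℕ, ⋃ _ : 1 ≤ p, typeIpSet φ F p

/-- The set `M_{II_1}`: points outside `M_I` with
`liminf_n (1/n) ∑_{j=1}^n e^{β S_j(F)(x)} > 0`. The lower limit is taken in `[0, ∞]`,
since the averages may be unbounded. -/
def typeIIOneSet (φ : X ≃ₜ X) (F : X → ℝ) (β : ℝ) : Set X :=
  {x | 0 < liminf (fun n : ℕ => ENNReal.ofReal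
      ((1 / (n : ℝ)) * ∑ j ∈ Finset.Icc 1 n, Real.exp (β * orbitSum φ F (j : ℤ) x))) atTop}
    \ typeISet φ F β

variable [MeasurableSpace X]

/-- An `e^{βF}`-conformal measure for `φ`: a Borel probability measure `m` with
`m(φ(B)) = ∫_B e^{βF} dm` for all Borel sets `B`. -/
structure IsConformal (φ : X ≃ₜ X) (F : X → ℝ) (β : ℝ) (m : Measure X) : Prop where
  isProbabilityMeasure : IsProbabilityMeasure m
  measure_image : ∀ B : Set X, MeasurableSet B →
    m (φ '' B) = ∫⁻ x in B, ENNReal.ofReal (Real.exp (β * F x)) ∂m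

/-- `IsTypeIIIPart φ F β m S` says that `S` is a possible choice of the set `M_{III}` of `m`:
an invariant Borel set such that the equation `βF = u ∘ φ - u` has a Borel solution on the
complement of `S`, and has none on an invariant Borel subset of `S` of positive measure.
For conformal `m` such a set exists and is unique up to an `m`-null set.
(Borel functions on a Borel subset are written as restrictions of Borel functions on `X`.) -/
structure IsTypeIIIPart (φ : X ≃ₜ X) (F : X → ℝ) (β : ℝ) (m : Measure X) (S : Set X) : Prop where
  measurableSet : MeasurableSet S
  invariant : φ ⁻¹' S = S
  exists_solution : ∃ u : X → ℝ, Measurable u ∧ ∀ x ∈ Sᶜ, β * F x = u (φ x) - u x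
  no_solution : ∀ A : Set X, A ⊆ S → MeasurableSet A → φ ⁻¹' A = A →
    ∀ u : X → ℝ, Measurable u → (∀ x ∈ A, β * F x = u (φ x) - u x) → m A = 0

/-- `m` is of type `II_1`: `m(M_{II_1}) = 1`. -/
def IsTypeIIOne (φ : X ≃ₜ X) (F : X → ℝ) (β : ℝ) (m : Measure X) : Prop :=
  m (typeIIOneSet φ F β) = 1

/-- `m` is of type `II_∞`: `m(M_{II_∞}) = 1`, where
`M_{II_∞} = X \ (M_I ∪ M_{II_1} ∪ M_{III})`. -/
def IsTypeIIInfty (φ : X ≃ₜ X) (F : X → ℝ) (β : ℝ) (m : Measure X) : Prop :=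
  ∃ S : Set X, IsTypeIIIPart φ F β m S ∧
    m (typeISet φ F β ∪ typeIIOneSet φ F β ∪ S)ᶜ = 1

/-- `m` is of type `III`: `m(M_{III}) = 1`. -/
def IsTypeIII (φ : X ≃ₜ X) (F : X → ℝ) (β : ℝ) (m : Measure X) : Prop :=
  ∃ S : Set X, IsTypeIIIPart φ F β m S ∧ m S = 1

end

end CrossedFlow

/-!
The potential is `F = ∑ k, (v k - v k ∘ φ)`, where the spikes `v k ≥ 0` have supports of summable
measure and are almost invariant under `φ`. Then `F` is a uniform limit of continuous coboundaries,
and `F = w - w ∘ φ` almost everywhere for the Lebesgue measure `μ`, where `w = ∑ k, v k` is finite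
almost everywhere but not integrable.

Coboundaries have conformal measures, and so have their uniform limits, by compactness. The spikes
are also almost invariant under `φ^n` for infinitely many `n`, along which the sums `S_n` are
therefore bounded, so `M_I` is empty. The lower limit `ρ` defining `M_{II_1}` satisfies
`ρ ∘ φ * exp (β * F) = ρ`, hence turns a conformal measure concentrated on `ρ > 0` into a finite
invariant measure, which is a multiple of `μ` by unique ergodicity. So there is at most one type
`II_1` measure. For `β ≥ 0` it is proportional to `exp (-β * w) * μ`, for which `ρ > 0` by the
maximal ergodic theorem. For `β < 0` it would have to be proportional to the same measure, which is
now infinite.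
-/

namespace CrossedFlow

open scoped Topology

section MaximalErgodic

variable {X : Type*} {T : X → X} {f : X → ℝ}

/-- The maximum of the Birkhoff sums of `f` of length at most `N`, by a recursion over `N` that is
convenient for the maximal ergodic theorem. -/
noncomputable def birkhoffMax (T : X → X) (f : X → ℝ) : ℕ → X → ℝ
  | 0, _ => 0
  | N + 1, x => max 0 (f x + birkhoffMax T f N (T x))

lemma birkhoffMax_nonneg : ∀ (N : ℕ) (x : X), 0 ≤ birkhoffMax T f N x
  | 0, _ => le_rfl
  | _ + 1, _ => le_max_left _ _

lemma birkhoffMax_le_succ (N : ℕ) (x : X) : birkhoffMax T f N x ≤ birkhoffMax T f (N + 1) x := by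
  induction N generalizing x with
  | zero => exact le_max_left _ _
  | succ N ih => exact max_le_max le_rfl (by gcongr; exact ih (T x))

lemma birkhoffSum_le_birkhoffMax (N : ℕ) (x : X) : birkhoffSum T f N x ≤ birkhoffMax T f N x := by
  induction N generalizing x with
  | zero => exact (birkhoffSum_zero T f x).le
  | succ N ih =>
    rw [birkhoffSum_succ']
    exact (add_le_add le_rfl (ih (T x))).trans (le_max_right _ _)

lemma exists_birkhoffSum_eq_birkhoffMax (N : ℕ) (x : X) :
    ∃ n, birkhoffSum T f n x = birkhoffMax T f N x := by
  induction N generalizing x with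
  | zero => exact ⟨0, birkhoffSum_zero T f x⟩
  | succ N ih =>
    obtain ⟨n, hn⟩ := ih (T x)
    rcases max_choice 0 (f x + birkhoffMax T f N (T x)) with h | h
    · exact ⟨0, (birkhoffSum_zero T f x).trans h.symm⟩
    · exact ⟨n + 1, by rw [birkhoffSum_succ', hn]; exact h.symm⟩

lemma iUnion_birkhoffMax_pos (T : X → X) (f : X → ℝ) :
    ⋃ N, {x | 0 < birkhoffMax T f N x} = {x | ∃ n, 0 < birkhoffSum T f n x} := by
  ext x
  simp only [mem_iUnion, mem_ofPred_eq]
  refine ⟨fun ⟨N, hN⟩ => ?_, fun ⟨n, hn⟩ => ⟨n, hn.trans_le (birkhoffSum_le_birkhoffMax n x)⟩⟩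
  obtain ⟨n, hn⟩ := exists_birkhoffSum_eq_birkhoffMax (T := T) (f := f) N x
  exact ⟨n, hn ▸ hN⟩

variable [MeasurableSpace X] {μ : Measure X}

lemma measurable_birkhoffMax (hT : Measurable T) (hf : Measurable f) :
    ∀ N, Measurable (birkhoffMax T f N)
  | 0 => measurable_const
  | N + 1 => measurable_const.max (hf.add ((measurable_birkhoffMax hT hf N).comp hT))

lemma integrable_birkhoffMax (hT : MeasurePreserving T μ μ) (hf : Integrable f μ) :
    ∀ N, Integrable (birkhoffMax T f N) μ
  | 0 => integrable_zero _ _ _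
  | N + 1 => (integrable_zero _ _ _).sup
      (hf.add (hT.integrable_comp_of_integrable (integrable_birkhoffMax hT hf N)))

lemma setIntegral_birkhoffMax_pos_nonneg (hT : MeasurePreserving T μ μ) (hfm : Measurable f)
    (hf : Integrable f μ) (N : ℕ) : 0 ≤ ∫ x in {x | 0 < birkhoffMax T f N x}, f x ∂μ := by
  set M := birkhoffMax T f N
  have hMm : Measurable M := measurable_birkhoffMax hT.measurable hfm N
  have hM : Integrable M μ := integrable_birkhoffMax hT hf N
  have hMT : Integrable (M ∘ T) μ := hT.integrable_comp_of_integrable hM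
  have hD : MeasurableSet {x | 0 < M x} := measurableSet_lt measurable_const hMm
  have hle : ∀ x, M x - M (T x) ≤ {x | 0 < M x}.indicator f x := fun x => by
    by_cases hx : 0 < M x
    · rw [indicator_of_mem (by exact hx), sub_le_iff_le_add]
      exact (le_max_iff.1 (birkhoffMax_le_succ N x)).resolve_left hx.not_ge
    · rw [indicator_of_notMem (by exact hx)]
      exact sub_nonpos.2 ((not_lt.1 hx).trans (birkhoffMax_nonneg N (T x)))
  calc (0 : ℝ) = ∫ x, M x ∂μ - ∫ x, M (T x) ∂μ := by
        rw [← integral_map hT.measurable.aemeasurable hMm.aestronglyMeasurable, hT.map_eq, sub_self]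
    _ = ∫ x, M x - M (T x) ∂μ := (integral_sub hM hMT).symm
    _ ≤ ∫ x, {x | 0 < M x}.indicator f x ∂μ := integral_mono (hM.sub hMT) (hf.indicator hD) hle
    _ = ∫ x in {x | 0 < M x}, f x ∂μ := integral_indicator hD

theorem setIntegral_exists_birkhoffSum_pos_nonneg (hT : MeasurePreserving T μ μ)
    (hfm : Measurable f) (hf : Integrable f μ) :
    0 ≤ ∫ x in {x | ∃ n, 0 < birkhoffSum T f n x}, f x ∂μ := by
  rw [← iUnion_birkhoffMax_pos]
  exact ge_of_tendsto' (tendsto_setIntegral_of_monotone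
    (fun N => measurableSet_lt measurable_const (measurable_birkhoffMax hT.measurable hfm N))
    (monotone_nat_of_le_succ fun N x (hx : 0 < _) => hx.trans_le (birkhoffMax_le_succ N x))
    hf.integrableOn) (setIntegral_birkhoffMax_pos_nonneg hT hfm hf)

theorem setIntegral_exists_birkhoffSum_lt_le [IsFiniteMeasure μ] (hT : MeasurePreserving T μ μ)
    (hfm : Measurable f) (hf : Integrable f μ) (δ : ℝ) :
    ∫ x in {x | ∃ n : ℕ, birkhoffSum T f n x < n * δ}, f x ∂μ ≤
      δ * μ.real {x | ∃ n : ℕ, birkhoffSum T f n x < n * δ} := by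
  have hsum : ∀ n x, birkhoffSum T (fun x => δ - f x) n x = n * δ - birkhoffSum T f n x :=
    fun n x => by simp [birkhoffSum, Finset.sum_sub_distrib]
  have h := setIntegral_exists_birkhoffSum_pos_nonneg (f := fun x => δ - f x) hT
    (measurable_const.sub hfm) ((integrable_const δ).sub hf)
  simp only [hsum, sub_pos] at h
  rw [integral_sub (integrable_const δ) hf.integrableOn, setIntegral_const, smul_eq_mul,
    mul_comm] at h
  exact sub_nonneg.1 h

theorem ae_exists_mul_le_birkhoffSum [IsFiniteMeasure μ] (hT : MeasurePreserving T μ μ)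
    (hfm : Measurable f) (hf : Integrable f μ) (hpos : ∀ x, 0 < f x) :
    ∀ᵐ x ∂μ, ∃ δ > 0, ∀ n : ℕ, n * δ ≤ birkhoffSum T f n x := by
  set B := {x | ¬ ∃ δ > 0, ∀ n : ℕ, n * δ ≤ birkhoffSum T f n x}
  have hB : ∀ δ > 0, ∫ x in B, f x ∂μ ≤ δ * μ.real univ := fun δ hδ =>
    calc ∫ x in B, f x ∂μ ≤ ∫ x in {x | ∃ n : ℕ, birkhoffSum T f n x < n * δ}, f x ∂μ := by
          refine setIntegral_mono_set hf.integrableOn (ae_of_all _ fun x => (hpos x).le)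
            (LE.le.eventuallyLE fun x hx => ?_)
          by_contra hn
          exact hx ⟨δ, hδ, fun n => not_lt.1 fun h => hn ⟨n, h⟩⟩
      _ ≤ δ * μ.real {x | ∃ n : ℕ, birkhoffSum T f n x < n * δ} :=
          setIntegral_exists_birkhoffSum_lt_le hT hfm hf δ
      _ ≤ δ * μ.real univ :=
          mul_le_mul_of_nonneg_left (measureReal_mono (subset_univ _)) hδ.le
  have h0 : ∫ x in B, f x ∂μ ≤ 0 := by
    refine ge_of_tendsto (x := 𝓝[>] (0 : ℝ)) ?_ (eventually_mem_nhdsWithin.mono hB)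
    have h : Tendsto (fun δ : ℝ => δ * μ.real univ) (𝓝 0) (𝓝 (0 * μ.real univ)) :=
      tendsto_id.mul_const _
    rw [zero_mul] at h
    exact h.mono_left nhdsWithin_le_nhds
  have hae : ∀ᵐ x ∂μ.restrict B, f x = 0 :=
    (integral_eq_zero_iff_of_nonneg (fun x => (hpos x).le) hf.integrableOn).1
      (h0.antisymm (integral_nonneg fun x => (hpos x).le))
  have hfalse : ∀ᵐ _ ∂μ.restrict B, False := hae.mono fun x hx => (hpos x).ne' hx
  exact Measure.restrict_eq_zero.1 (ae_eq_bot.1 (eventually_false_iff_eq_bot.1 hfalse))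

end MaximalErgodic

section UniqueErgodicity

/-- `T` preserves `μ`, and `μ` is the only finite measure preserved by `T` up to scaling. -/
structure IsUniquelyErgodic {X : Type*} [MeasurableSpace X] (T : X → X) (μ : Measure X) :
    Prop where
  measurePreserving : MeasurePreserving T μ μ
  eq_smul : ∀ (ν : Measure X) [IsFiniteMeasure ν], MeasurePreserving T ν ν → ν = ν univ • μ

theorem IsUniquelyErgodic.ergodic {X : Type*} [MeasurableSpace X] {T : X → X} {μ : Measure X}
    [IsFiniteMeasure μ] (h : IsUniquelyErgodic T μ) : Ergodic T μ where
  toMeasurePreserving := h.measurePreserving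
  aeconst_set s hs hTs := by
    have hrestrict : MeasurePreserving T (μ.restrict s) (μ.restrict s) := by
      simpa only [hTs] using h.measurePreserving.restrict_preimage hs
    have hmul := congr_arg (· sᶜ) (h.eq_smul (μ.restrict s) hrestrict)
    simp only [Measure.restrict_apply hs.compl, compl_inter_self, measure_empty,
      Measure.restrict_apply_univ, Measure.smul_apply, smul_eq_mul] at hmul
    rw [eventuallyConst_set']
    exact (mul_eq_zero.1 hmul.symm).imp ae_eq_empty.2 ae_eq_univ.2

lemma isAddLeftInvariant_of_denseRange_nsmul {G : Type*} [AddMonoid G] [TopologicalSpace G]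
    [ContinuousAdd G] [FirstCountableTopology G] [HasOuterApproxClosed G] [MeasurableSpace G]
    [BorelSpace G] {ν : Measure G} [IsFiniteMeasure ν] {a : G}
    (ha : DenseRange (· • a : ℕ → G)) (h : MeasurePreserving (a + ·) ν ν) :
    ν.IsAddLeftInvariant where
  map_add_left_eq_self t := by
    refine ext_of_forall_integral_eq_of_IsFiniteMeasure fun f => ?_
    have hmap : ∀ s, ∫ x, f x ∂ν.map (s + ·) = ∫ x, f (s + x) ∂ν := fun s =>
      integral_map (measurable_const_add s).aemeasurable f.continuous.aestronglyMeasurable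
    have hcont : Continuous fun s => ∫ x, f (s + x) ∂ν :=
      continuous_of_dominated (fun s => Continuous.aestronglyMeasurable (by fun_prop))
        (fun s => ae_of_all _ fun x => f.norm_coe_le_norm _) (integrable_const ‖f‖)
        (ae_of_all _ fun x => by fun_prop)
    have hnsmul : ∀ n : ℕ, ∫ x, f (n • a + x) ∂ν = ∫ x, f x ∂ν := fun n => by
      rw [← hmap, ← add_left_iterate, (h.iterate n).map_eq]
    rw [hmap]
    exact congr_fun (ha.equalizer hcont continuous_const (funext hnsmul)) t

theorem isUniquelyErgodic_add_left {G : Type*} [AddGroup G] [TopologicalSpace G]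
    [IsTopologicalAddGroup G] [CompactSpace G] [SecondCountableTopology G] [HasOuterApproxClosed G]
    [MeasurableSpace G] [BorelSpace G] (μ : Measure G) [μ.IsAddHaarMeasure]
    [IsProbabilityMeasure μ] {a : G} (ha : DenseRange (· • a : ℤ → G)) :
    IsUniquelyErgodic (a + ·) μ where
  measurePreserving := measurePreserving_add_left μ a
  eq_smul ν _ hν := by
    have := isAddLeftInvariant_of_denseRange_nsmul (denseRange_zsmul_iff_nsmul.1 ha) hν
    have hν := Measure.isAddLeftInvariant_eq_smul ν μ
    have huniv : ν univ = ν.addHaarScalarFactor μ := by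
      conv_lhs => rw [hν]
      simp
    rw [huniv]
    exact hν

end UniqueErgodicity

section LowerExpAverage

variable {X : Type*} [TopologicalSpace X] {φ : X ≃ₜ X} {F : X → ℝ} {β : ℝ}

lemma orbitSum_natCast (φ : X ≃ₜ X) (F : X → ℝ) (n : ℕ) (x : X) :
    orbitSum φ F n x = birkhoffSum φ F n x :=
  rfl

/-- The average of `exp (β * S_j)` over `1 ≤ j ≤ n`, in `[0, ∞]` because its lower limit may be
infinite. -/
noncomputable def expAverage (φ : X ≃ₜ X) (F : X → ℝ) (β : ℝ) (n : ℕ) (x : X) : ENNReal :=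
  ENNReal.ofReal (1 / (n : ℝ) * ∑ j ∈ Finset.Icc 1 n, Real.exp (β * orbitSum φ F (j : ℤ) x))

/-- The lower limit of the averages of `exp (β * S_j)`, whose positivity defines `M_{II_1}`. It is
the density that turns conformal measures into invariant ones. -/
noncomputable def lowerExpAverage (φ : X ≃ₜ X) (F : X → ℝ) (β : ℝ) (x : X) : ENNReal :=
  liminf (fun n => expAverage φ F β n x) atTop

lemma typeIIOneSet_eq (φ : X ≃ₜ X) (F : X → ℝ) (β : ℝ) :
    typeIIOneSet φ F β = {x | 0 < lowerExpAverage φ F β x} \ typeISet φ F β :=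
  rfl

lemma expAverage_eq_sum_range (φ : X ≃ₜ X) (F : X → ℝ) (β : ℝ) (n : ℕ) (x : X) :
    expAverage φ F β n x = ENNReal.ofReal
      (1 / (n : ℝ) * ∑ j ∈ Finset.range n, Real.exp (β * birkhoffSum φ F (j + 1) x)) := by
  have hIcc : Finset.Icc 1 n = Finset.Ico (0 + 1) (n + 1) := by ext; simp
  rw [expAverage, hIcc, ← Finset.sum_Ico_add', ← Finset.range_eq_Ico]
  rfl

lemma expAverage_succ (φ : X ≃ₜ X) (F : X → ℝ) (β : ℝ) (n : ℕ) (x : X) :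
    expAverage φ F β (n + 1) x =
      ENNReal.ofReal (n / (n + 1)) *
          (ENNReal.ofReal (Real.exp (β * F x)) * expAverage φ F β n (φ x)) +
        ENNReal.ofReal (1 / (n + 1) * Real.exp (β * F x)) := by
  have hsum : ∑ j ∈ Finset.range (n + 1), Real.exp (β * birkhoffSum φ F (j + 1) x) =
      Real.exp (β * F x) *
        (∑ j ∈ Finset.range n, Real.exp (β * birkhoffSum φ F (j + 1) (φ x)) + 1) := by
    simp only [birkhoffSum_succ' _ _ _ x, mul_add β, Real.exp_add, ← Finset.mul_sum]
    rw [Finset.sum_range_succ', birkhoffSum_zero, mul_zero, Real.exp_zero]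
  rw [expAverage_eq_sum_range, expAverage_eq_sum_range, hsum,
    ← ENNReal.ofReal_mul (by positivity), ← ENNReal.ofReal_mul (by positivity),
    ← ENNReal.ofReal_add (by positivity) (by positivity)]
  congr 1
  rcases eq_or_ne n 0 with rfl | hn
  · simp
  · push_cast
    field_simp

lemma liminf_mul_of_tendsto_one {u c : ℕ → ENNReal} (hc : Tendsto c atTop (𝓝 1)) :
    liminf (fun n => c n * u n) atTop = liminf u atTop := by
  refine le_antisymm ((ENNReal.liminf_mul_le ?_ ?_).trans_eq ?_)
    (ENNReal.le_liminf_mul.trans' (le_of_eq ?_))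
  · simp [hc.limsup_eq]
  · simp [hc.limsup_eq]
  · rw [hc.limsup_eq, one_mul]
  · rw [hc.liminf_eq, one_mul]

theorem lowerExpAverage_comp_mul (φ : X ≃ₜ X) (F : X → ℝ) (β : ℝ) (x : X) :
    lowerExpAverage φ F β (φ x) * ENNReal.ofReal (Real.exp (β * F x)) =
      lowerExpAverage φ F β x := by
  have hone : Tendsto (fun n : ℕ => ENNReal.ofReal (n / (n + 1))) atTop (𝓝 1) := by
    simpa using ENNReal.tendsto_ofReal (tendsto_natCast_div_add_atTop (1 : ℝ))
  have hzero : Tendsto (fun n : ℕ => ENNReal.ofReal (1 / (n + 1) * Real.exp (β * F x))) atTop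
      (𝓝 0) := by
    simpa using ENNReal.tendsto_ofReal
      ((tendsto_one_div_add_atTop_nhds_zero_nat (𝕜 := ℝ)).mul_const (Real.exp (β * F x)))
  symm
  calc lowerExpAverage φ F β x
      = liminf (fun n => expAverage φ F β (n + 1) x) atTop := (liminf_nat_add _ 1).symm
    _ = liminf (fun n : ℕ => ENNReal.ofReal (n / (n + 1)) *
          (ENNReal.ofReal (Real.exp (β * F x)) * expAverage φ F β n (φ x))) atTop := by
        simp only [expAverage_succ]
        exact ENNReal.liminf_add_of_right_tendsto_zero hzero _
    _ = liminf (fun n => ENNReal.ofReal (Real.exp (β * F x)) * expAverage φ F β n (φ x)) atTop :=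
        liminf_mul_of_tendsto_one hone
    _ = lowerExpAverage φ F β (φ x) * ENNReal.ofReal (Real.exp (β * F x)) := by
        rw [ENNReal.liminf_const_mul_of_ne_top ENNReal.ofReal_ne_top, mul_comm, lowerExpAverage]

variable [MeasurableSpace X] [BorelSpace X]

lemma measurable_orbitSum_natCast (φ : X ≃ₜ X) (hF : Measurable F) (n : ℕ) :
    Measurable (orbitSum φ F n) :=
  Finset.measurable_fun_sum _ fun j _ => hF.comp (φ.measurable.iterate j)

lemma measurable_expAverage (φ : X ≃ₜ X) (hF : Measurable F) (β : ℝ) (n : ℕ) :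
    Measurable (expAverage φ F β n) :=
  (measurable_const.mul (Finset.measurable_fun_sum _ fun j _ =>
    ((measurable_orbitSum_natCast φ hF j).const_mul β).exp)).ennreal_ofReal

lemma measurable_lowerExpAverage (φ : X ≃ₜ X) (hF : Measurable F) (β : ℝ) :
    Measurable (lowerExpAverage φ F β) :=
  Measurable.liminf (measurable_expAverage φ hF β)

end LowerExpAverage

section Conformal

lemma measurable_ofReal_exp_mul {Y : Type*} [MeasurableSpace Y] {f : Y → ℝ} (hf : Measurable f)
    (c : ℝ) : Measurable fun y => ENNReal.ofReal (Real.exp (c * f y)) :=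
  (hf.const_mul c).exp.ennreal_ofReal

lemma eq_of_eq_smul {Y : Type*} [MeasurableSpace Y] {m₁ m₂ κ : Measure Y} [IsProbabilityMeasure m₁]
    [IsProbabilityMeasure m₂] {c₁ c₂ : ENNReal} (h₁ : m₁ = c₁ • κ) (h₂ : m₂ = c₂ • κ) :
    m₁ = m₂ := by
  have hmass : ∀ {c : ENNReal} {m : Measure Y} [IsProbabilityMeasure m], m = c • κ →
      c = (κ univ)⁻¹ := fun {c m} _ h =>
    ENNReal.eq_inv_of_mul_eq_one_left (by
      simpa only [Measure.smul_apply, smul_eq_mul, measure_univ] using congr_arg (· univ) h.symm)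
  rw [h₁, h₂, hmass h₁, hmass h₂]

variable {X : Type*} [TopologicalSpace X] [MeasurableSpace X] [BorelSpace X] {φ : X ≃ₜ X}
  {F : X → ℝ} {β : ℝ} {m μ : Measure X}

lemma isConformal_iff_map_withDensity_eq [IsProbabilityMeasure m] :
    IsConformal φ F β m ↔
      (m.withDensity fun x => ENNReal.ofReal (Real.exp (β * F x))).map φ = m := by
  refine ⟨fun h => ?_, fun h => ⟨inferInstance, fun B hB => ?_⟩⟩
  · ext B hB
    rw [Measure.map_apply φ.measurable hB, withDensity_apply _ (φ.measurable hB),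
      ← h.measure_image _ (φ.measurable hB), image_preimage_eq _ φ.surjective]
  · conv_lhs => rw [← h]
    rw [φ.measurableEmbedding.map_apply, preimage_image_eq _ φ.injective, withDensity_apply _ hB]

namespace IsConformal

lemma lintegral_comp_mul (hm : IsConformal φ F β m) (hF : Measurable F) {g : X → ENNReal}
    (hg : Measurable g) :
    ∫⁻ x, g (φ x) * ENNReal.ofReal (Real.exp (β * F x)) ∂m = ∫⁻ x, g x ∂m := by
  have := hm.isProbabilityMeasure
  conv_rhs => rw [← isConformal_iff_map_withDensity_eq.1 hm, lintegral_map hg φ.measurable]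
  rw [lintegral_withDensity_eq_lintegral_mul _ (measurable_ofReal_exp_mul hF β)
    (g := fun x => g (φ x)) (hg.comp φ.measurable)]
  simp only [Pi.mul_apply, mul_comm]

lemma lintegral_exp_orbitSum (hm : IsConformal φ F β m) (hF : Measurable F) (n : ℕ) :
    ∫⁻ x, ENNReal.ofReal (Real.exp (β * orbitSum φ F n x)) ∂m = 1 := by
  have := hm.isProbabilityMeasure
  induction n with
  | zero => simp [orbitSum]
  | succ n ih =>
    rw [← ih, ← hm.lintegral_comp_mul hF
      (measurable_ofReal_exp_mul (measurable_orbitSum_natCast φ hF n) β)]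
    refine lintegral_congr fun x => ?_
    rw [orbitSum_natCast, birkhoffSum_succ', mul_add, Real.exp_add, mul_comm,
      ENNReal.ofReal_mul (by positivity), orbitSum_natCast]

lemma lintegral_expAverage (hm : IsConformal φ F β m) (hF : Measurable F) {n : ℕ} (hn : n ≠ 0) :
    ∫⁻ x, expAverage φ F β n x ∂m = 1 := by
  have hmeas : ∀ j : ℕ, Measurable fun x => ENNReal.ofReal (Real.exp (β * orbitSum φ F j x)) :=
    fun j => measurable_ofReal_exp_mul (measurable_orbitSum_natCast φ hF j) β
  calc ∫⁻ x, expAverage φ F β n x ∂m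
      = ∫⁻ x, ENNReal.ofReal (1 / n) *
          ∑ j ∈ Finset.Icc 1 n, ENNReal.ofReal (Real.exp (β * orbitSum φ F (j : ℤ) x)) ∂m := by
        refine lintegral_congr fun x => ?_
        rw [expAverage, ENNReal.ofReal_mul (by positivity),
          ENNReal.ofReal_sum_of_nonneg fun j _ => by positivity]
    _ = ENNReal.ofReal (1 / n) * ∑ j ∈ Finset.Icc 1 n, 1 := by
        rw [lintegral_const_mul _ (Finset.measurable_fun_sum _ fun j _ => hmeas j),
          lintegral_finsetSum _ fun j _ => hmeas j]
        simp only [hm.lintegral_exp_orbitSum hF]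
    _ = 1 := by
        rw [Finset.sum_const, Nat.card_Icc, add_tsub_cancel_right, nsmul_one,
          ← ENNReal.ofReal_natCast n, ← ENNReal.ofReal_mul (by positivity),
          one_div_mul_cancel (by exact_mod_cast hn), ENNReal.ofReal_one]

lemma lintegral_lowerExpAverage_le (hm : IsConformal φ F β m) (hF : Measurable F) :
    ∫⁻ x, lowerExpAverage φ F β x ∂m ≤ 1 := by
  refine (lintegral_liminf_le (measurable_expAverage φ hF β)).trans_eq (Tendsto.liminf_eq ?_)
  exact tendsto_const_nhds.congr' ((eventually_ne_atTop 0).mono fun n hn =>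
    (hm.lintegral_expAverage hF hn).symm)

/-- A density with the cocycle property of `exp (β * w)`, where `F = w - w ∘ φ`, turns conformal
measures into invariant ones. -/
theorem measurePreserving_withDensity (hm : IsConformal φ F β m) (hF : Measurable F)
    {ρ : X → ENNReal} (hρ : Measurable ρ)
    (hcocycle : ∀ᵐ x ∂m, ρ (φ x) * ENNReal.ofReal (Real.exp (β * F x)) = ρ x) :
    MeasurePreserving φ (m.withDensity ρ) (m.withDensity ρ) := by
  refine ⟨φ.measurable, ?_⟩
  ext B hB
  rw [Measure.map_apply φ.measurable hB, withDensity_apply _ (φ.measurable hB),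
    withDensity_apply _ hB, ← lintegral_indicator hB, ← lintegral_indicator (φ.measurable hB),
    ← hm.lintegral_comp_mul hF (hρ.indicator hB)]
  refine lintegral_congr_ae (hcocycle.mono fun x hx => ?_)
  by_cases hxB : φ x ∈ B
  · simp only [indicator_of_mem hxB, indicator_of_mem (mem_preimage.2 hxB), hx]
  · simp only [indicator_of_notMem hxB, indicator_of_notMem (mt mem_preimage.1 hxB), zero_mul]

theorem eq_smul_withDensity_inv (hm : IsConformal φ F β m) (hφ : IsUniquelyErgodic φ μ)
    (hF : Measurable F) {ρ : X → ENNReal} (hρ : Measurable ρ)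
    (hcocycle : ∀ᵐ x ∂m, ρ (φ x) * ENNReal.ofReal (Real.exp (β * F x)) = ρ x)
    (hpos : ∀ᵐ x ∂m, ρ x ≠ 0) (hint : ∫⁻ x, ρ x ∂m ≠ ⊤) :
    m = (∫⁻ x, ρ x ∂m) • μ.withDensity fun x => (ρ x)⁻¹ := by
  have := isFiniteMeasure_withDensity hint
  have heq := hφ.eq_smul _ (hm.measurePreserving_withDensity hF hρ hcocycle)
  rw [withDensity_apply _ MeasurableSet.univ, Measure.restrict_univ] at heq
  conv_lhs => rw [← withDensity_inv_same hρ hpos ((ae_lt_top hρ hint).mono fun x hx => hx.ne), heq]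
  rw [withDensity_smul_measure]

theorem eq_smul_withDensity_lowerExpAverage_inv (hm : IsConformal φ F β m)
    (hφ : IsUniquelyErgodic φ μ) (hF : Measurable F) (hpos : ∀ᵐ x ∂m, 0 < lowerExpAverage φ F β x) :
    m = (∫⁻ x, lowerExpAverage φ F β x ∂m) •
      μ.withDensity fun x => (lowerExpAverage φ F β x)⁻¹ :=
  hm.eq_smul_withDensity_inv hφ hF (measurable_lowerExpAverage φ hF β)
    (ae_of_all _ fun x => lowerExpAverage_comp_mul φ F β x) (hpos.mono fun _ hx => hx.ne')
    (ne_top_of_le_ne_top ENNReal.one_ne_top (hm.lintegral_lowerExpAverage_le hF))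

theorem measure_typeIIOneSet_eq_zero (hm : IsConformal φ F β m) (herg : PreErgodic φ m)
    (hF : Measurable F) (hnot : ¬ ∀ᵐ x ∂m, 0 < lowerExpAverage φ F β x) :
    m (typeIIOneSet φ F β) = 0 := by
  have := hm.isProbabilityMeasure
  have hmeas : MeasurableSet {x | 0 < lowerExpAverage φ F β x} :=
    measurableSet_lt measurable_const (measurable_lowerExpAverage φ hF β)
  have hinv : φ ⁻¹' {x | 0 < lowerExpAverage φ F β x} = {x | 0 < lowerExpAverage φ F β x} := by
    ext x
    rw [mem_preimage, mem_ofPred_eq, mem_ofPred_eq, ← lowerExpAverage_comp_mul φ F β x,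
      ENNReal.mul_pos_iff]
    simp [Real.exp_pos]
  rw [typeIIOneSet_eq]
  refine measure_mono_null sdiff_subset ((herg.prob_eq_zero_or_one hmeas hinv).resolve_right ?_)
  exact fun hone => hnot ((prob_compl_eq_zero_iff hmeas).2 hone)

end IsConformal

lemma IsTypeIIOne.ae_lowerExpAverage_pos [IsProbabilityMeasure m] (hF : Measurable F)
    (hm : IsTypeIIOne φ F β m) : ∀ᵐ x ∂m, 0 < lowerExpAverage φ F β x := by
  have hone : m {x | 0 < lowerExpAverage φ F β x} = 1 :=
    le_antisymm prob_le_one (hm.symm.trans_le (measure_mono sdiff_subset))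
  exact (prob_compl_eq_zero_iff
    (measurableSet_lt measurable_const (measurable_lowerExpAverage φ hF β))).2 hone

end Conformal

section Coboundary

lemma ae_birkhoffSum_eq_sub {Y : Type*} [MeasurableSpace Y] {ν : Measure Y} {T : Y → Y}
    {f w : Y → ℝ} (hT : MeasurePreserving T ν ν) (hfw : f =ᵐ[ν] w - w ∘ T) :
    ∀ᵐ x ∂ν, ∀ n, birkhoffSum T f n x = w x - w (T^[n] x) := by
  have hiter : ∀ᵐ x ∂ν, ∀ j, f (T^[j] x) = w (T^[j] x) - w (T (T^[j] x)) :=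
    ae_all_iff.2 fun j => (hT.iterate j).quasiMeasurePreserving.ae hfw
  filter_upwards [hiter] with x hx n
  simp only [birkhoffSum, hx, ← Function.iterate_succ_apply']
  exact Finset.sum_range_sub' (fun j => w (T^[j] x)) n

variable {X : Type*} [TopologicalSpace X] [MeasurableSpace X] {φ : X ≃ₜ X} {F w : X → ℝ}
  {β : ℝ} {m μ : Measure X}

theorem ae_lowerExpAverage_pos [IsFiniteMeasure μ] (hμ : MeasurePreserving φ μ μ)
    (hw : Measurable w) (hFw : F =ᵐ[μ] w - w ∘ φ)
    (hint : Integrable (fun x => Real.exp (-β * w x)) μ) :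
    ∀ᵐ x ∂μ, 0 < lowerExpAverage φ F β x := by
  filter_upwards [ae_birkhoffSum_eq_sub hμ hFw, hμ.quasiMeasurePreserving.ae
    (ae_exists_mul_le_birkhoffSum hμ (hw.const_mul (-β)).exp hint fun x => Real.exp_pos _)]
    with x hsum ⟨δ, hδ, hle⟩
  have haverage : ∀ n ≠ 0, ENNReal.ofReal (Real.exp (β * w x) * δ) ≤ expAverage φ F β n x :=
    fun n hn => by
    have hterm : ∀ j, Real.exp (β * birkhoffSum φ F (j + 1) x) =
        Real.exp (β * w x) * Real.exp (-β * w (φ^[j] (φ x))) := fun j => by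
      rw [hsum, ← Real.exp_add, Function.iterate_succ_apply]
      ring_nf
    rw [expAverage_eq_sum_range]
    simp only [hterm, ← Finset.mul_sum]
    refine ENNReal.ofReal_le_ofReal ?_
    rw [one_div_mul_eq_div, le_div_iff₀ (by positivity), mul_assoc, mul_comm δ]
    gcongr
    exact hle n
  exact (ENNReal.ofReal_pos.2 (by positivity)).trans_le
    (le_liminf_of_le (by isBoundedDefault) ((eventually_ne_atTop 0).mono haverage))

variable [BorelSpace X]

theorem isConformal_tilted [NeZero μ] (hμ : MeasurePreserving φ μ μ) (hFw : F =ᵐ[μ] w - w ∘ φ)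
    (hint : Integrable (fun x => Real.exp (-β * w x)) μ) :
    IsConformal φ F β (μ.tilted fun x => -β * w x) where
  isProbabilityMeasure := isProbabilityMeasure_tilted hint
  measure_image B hB := by
    rw [tilted_apply' _ _ (φ.measurableEmbedding.measurableSet_image.2 hB),
      setLIntegral_tilted' _ _ hB,
      ← hμ.setLIntegral_comp_emb φ.measurableEmbedding]
    refine setLIntegral_congr_fun_ae hB (hFw.mono fun x hx _ => ?_)
    rw [← ENNReal.ofReal_mul (by positivity), div_mul_eq_mul_div, ← Real.exp_add, hx]
    simp only [Pi.sub_apply, Function.comp_apply]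
    ring_nf

theorem existsUnique_isTypeIIOne [IsProbabilityMeasure μ] (hφ : IsUniquelyErgodic φ μ)
    (hF : Measurable F) (hw : Measurable w) (hFw : F =ᵐ[μ] w - w ∘ φ)
    (hint : Integrable (fun x => Real.exp (-β * w x)) μ) (hI : μ (typeISet φ F β) = 0) :
    ∃! m : Measure X, IsConformal φ F β m ∧ PreErgodic φ m ∧ IsTypeIIOne φ F β m := by
  have hpos : ∀ᵐ x ∂μ, 0 < lowerExpAverage φ F β x :=
    ae_lowerExpAverage_pos hφ.measurePreserving hw hFw hint
  have hconf : IsConformal φ F β (μ.tilted fun x => -β * w x) :=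
    isConformal_tilted hφ.measurePreserving hFw hint
  have := hconf.isProbabilityMeasure
  have hac : μ.tilted (fun x => -β * w x) ≪ μ := tilted_absolutelyContinuous μ _
  refine ⟨_, ⟨hconf, ⟨fun s hs hφs => ?_⟩, ?_⟩, fun m ⟨hm, _, hII⟩ => ?_⟩
  · exact (hφ.ergodic.aeconst_set hs hφs).anti hac.ae_le
  · rw [IsTypeIIOne, typeIIOneSet_eq, measure_sdiff_null (hac hI)]
    exact (prob_compl_eq_zero_iff (measurableSet_lt measurable_const
      (measurable_lowerExpAverage φ hF β))).1 (hac.ae_le hpos)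
  · have := hm.isProbabilityMeasure
    exact eq_of_eq_smul
      (hm.eq_smul_withDensity_lowerExpAverage_inv hφ hF (hII.ae_lowerExpAverage_pos hF))
      (hconf.eq_smul_withDensity_lowerExpAverage_inv hφ hF (hac.ae_le hpos))

theorem IsConformal.not_ae_lowerExpAverage_pos (hm : IsConformal φ F β m)
    (hφ : IsUniquelyErgodic φ μ) (hF : Measurable F) (hw : Measurable w) (hFw : F =ᵐ[μ] w - w ∘ φ)
    (hβ : β ≤ 0) (hnonneg : 0 ≤ w) (htop : ∫⁻ x, ENNReal.ofReal (Real.exp (-β * w x)) ∂μ = ⊤) :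
    ¬ ∀ᵐ x ∂m, 0 < lowerExpAverage φ F β x := by
  intro hpos
  have := hm.isProbabilityMeasure
  have hac : m ≪ μ := by
    rw [hm.eq_smul_withDensity_lowerExpAverage_inv hφ hF hpos]
    exact (withDensity_absolutelyContinuous μ _).smul_left _
  have hint : ∫⁻ x, ENNReal.ofReal (Real.exp (β * w x)) ∂m ≤ 1 :=
    calc ∫⁻ x, ENNReal.ofReal (Real.exp (β * w x)) ∂m ≤ ∫⁻ _, 1 ∂m :=
          lintegral_mono fun x => ENNReal.ofReal_le_one.2
            (Real.exp_le_one_iff.2 (mul_nonpos_of_nonpos_of_nonneg hβ (hnonneg x)))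
      _ = 1 := by rw [lintegral_one, measure_univ]
  have heq := hm.eq_smul_withDensity_inv hφ hF (measurable_ofReal_exp_mul hw β)
    ((hac.ae_eq hFw).mono fun x hx => by
      rw [← ENNReal.ofReal_mul (by positivity), ← Real.exp_add, hx]
      simp only [Pi.sub_apply, Function.comp_apply]
      ring_nf)
    (ae_of_all _ fun x => (ENNReal.ofReal_pos.2 (Real.exp_pos _)).ne')
    (ne_top_of_le_ne_top ENNReal.one_ne_top hint)
  have hmass := congr_arg (· univ) heq
  simp only [measure_univ, Measure.smul_apply, withDensity_apply _ MeasurableSet.univ,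
    Measure.restrict_univ, smul_eq_mul, ← ENNReal.ofReal_inv_of_pos (Real.exp_pos _),
    ← Real.exp_neg, ← neg_mul, htop] at hmass
  rcases eq_or_ne (∫⁻ x, ENNReal.ofReal (Real.exp (β * w x)) ∂m) 0 with h0 | h0
  · simp [h0] at hmass
  · simp [ENNReal.mul_top h0] at hmass

end Coboundary

theorem isTypeIIInfty_or_isTypeIII {X : Type*} [TopologicalSpace X] [MeasurableSpace X]
    {φ : X ≃ₜ X} {F : X → ℝ} {β : ℝ} {m : Measure X} [IsProbabilityMeasure m]
    (herg : PreErgodic φ m) (hI : m (typeISet φ F β) = 0) (hII : m (typeIIOneSet φ F β) = 0) :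
    IsTypeIIInfty φ F β m ∨ IsTypeIII φ F β m := by
  by_cases h : ∃ A : Set X, MeasurableSet A ∧ φ ⁻¹' A = A ∧
      (∃ u : X → ℝ, Measurable u ∧ ∀ x ∈ A, β * F x = u (φ x) - u x) ∧ m A ≠ 0
  · obtain ⟨A, hA, hAinv, hu, hmA⟩ := h
    have hAc : m Aᶜ = 0 :=
      (prob_compl_eq_zero_iff hA).2 ((herg.prob_eq_zero_or_one hA hAinv).resolve_left hmA)
    refine Or.inl ⟨Aᶜ, ⟨hA.compl, by rw [preimage_compl, hAinv], by rwa [compl_compl],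
      fun B hB _ _ _ _ _ => measure_mono_null hB hAc⟩, ?_⟩
    rw [compl_eq_univ_sdiff,
      measure_sdiff_null (measure_union_null (measure_union_null hI hII) hAc), measure_univ]
  · push Not at h
    exact Or.inr ⟨univ, ⟨MeasurableSet.univ, preimage_univ, ⟨0, measurable_zero, by simp⟩,
      fun A _ hA hAinv u hu hAu => h A hA hAinv ⟨u, hu, hAu⟩⟩, measure_univ⟩

section Existence

variable {X : Type*} [TopologicalSpace X] [CompactSpace X] [MeasurableSpace X] [BorelSpace X]

lemma continuous_integral_probabilityMeasure_prod :
    Continuous fun p : ProbabilityMeasure X × C(X, ℝ) => ∫ x, p.2 x ∂(p.1 : Measure X) := by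
  refine continuous_prod_of_continuous_lipschitzWith' _ 1 (fun μ => ?_) fun f => ?_
  · refine LipschitzWith.of_dist_le_mul fun f g => ?_
    have hint : ∀ h : C(X, ℝ), Integrable h (μ : Measure X) := fun h =>
      h.continuous.integrable_of_hasCompactSupport (HasCompactSupport.of_compactSpace h)
    calc dist (∫ x, f x ∂(μ : Measure X)) (∫ x, g x ∂(μ : Measure X))
        = ‖∫ x, (f - g) x ∂(μ : Measure X)‖ := by
          rw [dist_eq_norm, ← integral_sub (hint f) (hint g)]
          rfl
      _ ≤ ‖f - g‖ * (μ : Measure X).real univ :=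
          norm_integral_le_of_norm_le_const (ae_of_all _ (f - g).norm_coe_le_norm)
      _ = 1 * dist f g := by rw [probReal_univ, mul_one, one_mul, dist_eq_norm]
  · exact ProbabilityMeasure.continuous_integral_boundedContinuousFunction
      (BoundedContinuousFunction.mkOfCompact f)

variable [HasOuterApproxClosed X] {φ : X ≃ₜ X} {β : ℝ}

lemma isConformal_iff_integral_comp_mul {m : Measure X} [IsProbabilityMeasure m] {F : C(X, ℝ)} :
    IsConformal φ F β m ↔
      ∀ f : C(X, ℝ), ∫ x, f (φ x) * Real.exp (β * F x) ∂m = ∫ x, f x ∂m := by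
  have hmeas := measurable_ofReal_exp_mul F.measurable β
  have hexp : Integrable (fun x => Real.exp (β * F x)) m :=
    Continuous.integrable_of_hasCompactSupport (by fun_prop) (HasCompactSupport.of_compactSpace _)
  have := isFiniteMeasure_withDensity_ofReal hexp.hasFiniteIntegral
  have hmap : ∀ f : C(X, ℝ),
      ∫ x, f x ∂(m.withDensity fun x => ENNReal.ofReal (Real.exp (β * F x))).map φ =
        ∫ x, f (φ x) * Real.exp (β * F x) ∂m := fun f => by
    rw [integral_map φ.measurable.aemeasurable f.continuous.aestronglyMeasurable,
      integral_withDensity_eq_integral_toReal_smul hmeas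
        (ae_of_all _ fun x => ENNReal.ofReal_lt_top)]
    simp only [ENNReal.toReal_ofReal (Real.exp_pos _).le, smul_eq_mul, mul_comm]
  simp only [isConformal_iff_map_withDensity_eq, ← hmap]
  exact ⟨fun h f => by rw [h], fun h =>
    ext_of_forall_integral_eq_of_IsFiniteMeasure fun f => h f.toContinuousMap⟩

theorem isClosed_setOf_exists_isConformal [T2Space X] (φ : X ≃ₜ X) (β : ℝ) :
    IsClosed {F : C(X, ℝ) | ∃ m : Measure X, IsConformal φ F β m} := by
  set C : Set (ProbabilityMeasure X × C(X, ℝ)) :=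
    {p | ∀ f : C(X, ℝ), ∫ x, f (φ x) * Real.exp (β * p.2 x) ∂(p.1 : Measure X) =
      ∫ x, f x ∂(p.1 : Measure X)}
  have hC : IsClosed C := by
    simp only [C, ofPred_forall]
    refine isClosed_iInter fun f => isClosed_eq ?_ ?_
    · have hweight : Continuous fun F : C(X, ℝ) =>
          f.comp (φ : C(X, X)) * (⟨Real.exp, Real.continuous_exp⟩ : C(ℝ, ℝ)).comp (β • F) :=
        continuous_const.mul ((ContinuousMap.continuous_postcomp _).comp (continuous_const_smul β))
      exact continuous_integral_probabilityMeasure_prod.comp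
        (continuous_fst.prodMk (hweight.comp continuous_snd))
    · exact continuous_integral_probabilityMeasure_prod.comp
        (continuous_fst.prodMk continuous_const)
  convert! isClosedMap_snd_of_compactSpace C hC
  ext F
  constructor
  · rintro ⟨m, hm⟩
    have := hm.isProbabilityMeasure
    exact ⟨(⟨m, this⟩, F), isConformal_iff_integral_comp_mul.1 hm, rfl⟩
  · rintro ⟨⟨m, F⟩, hm, rfl⟩
    exact ⟨m, isConformal_iff_integral_comp_mul.2 hm⟩

end Existence

section TypeI

variable {X : Type*} [TopologicalSpace X] {φ : X ≃ₜ X} {F : X → ℝ} {β C : ℝ} {x : X} {n : ℕ → ℕ}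

lemma notMem_typeIInftySet (hn : Function.Injective n)
    (hbound : ∀ i, |orbitSum φ F (n i : ℤ) x| ≤ C) : x ∉ typeIInftySet φ F β := by
  intro hx
  have hzero : Tendsto (fun i => Real.exp (β * orbitSum φ F (n i : ℤ) x)) atTop (𝓝 0) :=
    (Summable.comp_injective hx (Nat.cast_injective.comp hn)).tendsto_atTop_zero
  refine (Real.exp_pos (-(|β| * C))).not_ge (ge_of_tendsto' hzero fun i => Real.exp_le_exp.2 ?_)
  calc -(|β| * C) ≤ -|β * orbitSum φ F (n i : ℤ) x| := by
        rw [abs_mul]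
        gcongr
        exact hbound i
    _ ≤ β * orbitSum φ F (n i : ℤ) x := neg_abs_le _

lemma notMem_typeISet (hx : x ∉ Function.periodicPts φ) (hn : Function.Injective n)
    (hbound : ∀ i, |orbitSum φ F (n i : ℤ) x| ≤ C) : x ∉ typeISet φ F β := by
  rintro (h | h)
  · exact notMem_typeIInftySet hn hbound h
  · simp only [mem_iUnion] at h
    obtain ⟨p, hp, hper, -⟩ := h
    exact hx (Function.mk_mem_periodicPts hp hper)

end TypeI

section SpikeSequence

variable {X : Type*} [TopologicalSpace X] {φ : X ≃ₜ X} {v : ℕ → C(X, ℝ)} {β : ℝ}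

/-- The sum of the coboundaries `v k - v k ∘ φ`, which converges uniformly for a spike sequence. -/
noncomputable def spikePotential (φ : X ≃ₜ X) (v : ℕ → C(X, ℝ)) : C(X, ℝ) :=
  ∑' k, (v k - (v k).comp (φ : C(X, X)))

/-- The solution of `F = w - w ∘ φ` for the potential `F` of a spike sequence; its value is the
default `0` on the null set where the sum diverges. -/
noncomputable def spikeTransfer (v : ℕ → C(X, ℝ)) (x : X) : ℝ :=
  ∑' k, v k x

lemma spikeTransfer_nonneg (hnonneg : ∀ k x, 0 ≤ v k x) : 0 ≤ spikeTransfer v :=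
  fun x => tsum_nonneg fun k => hnonneg k x

variable [MeasurableSpace X] {μ : Measure X}

/-- A sequence of nonnegative continuous functions whose coboundaries are uniformly summable, even
along an infinite sequence of return times, and whose sum is almost everywhere finite but not
integrable. -/
structure IsSpikeSequence (φ : X ≃ₜ X) (μ : Measure X) (v : ℕ → C(X, ℝ)) : Prop where
  nonneg : ∀ k x, 0 ≤ v k x
  abs_sub_le : ∀ k x, |v k x - v k (φ x)| ≤ (1 / 2) ^ k
  exists_return : ∃ n : ℕ → ℕ, StrictMono n ∧
    ∀ i k x, |v k x - v k (φ^[n i] x)| ≤ (1 / 2) ^ k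
  tsum_measure_support_ne_top : ∑' k, μ (Function.support (v k)) ≠ ⊤
  tsum_lintegral_eq_top : ∑' k, ∫⁻ x, ENNReal.ofReal (v k x) ∂μ = ⊤

lemma measurable_spikeTransfer [BorelSpace X] (v : ℕ → C(X, ℝ)) : Measurable (spikeTransfer v) :=
  Measurable.tsum fun k => (v k).continuous.measurable

lemma integrable_exp_spikeTransfer [BorelSpace X] [IsFiniteMeasure μ] (hnonneg : ∀ k x, 0 ≤ v k x)
    (hβ : 0 ≤ β) : Integrable (fun x => Real.exp (-β * spikeTransfer v x)) μ := by
  refine Integrable.of_bound ((measurable_spikeTransfer v).const_mul _).exp.aestronglyMeasurable 1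
    (ae_of_all _ fun x => ?_)
  rw [Real.norm_eq_abs, Real.abs_exp, Real.exp_le_one_iff, neg_mul, neg_nonpos]
  exact mul_nonneg hβ (spikeTransfer_nonneg hnonneg x)

namespace IsSpikeSequence

lemma ae_summable (hv : IsSpikeSequence φ μ v) : ∀ᵐ x ∂μ, Summable fun k => v k x := by
  filter_upwards [ae_eventually_notMem hv.tsum_measure_support_ne_top] with x hx
  obtain ⟨N, hN⟩ := eventually_atTop.1 hx
  refine summable_of_ne_finset_zero (s := Finset.range N) fun k hk => ?_
  exact Function.notMem_support.1 (hN k (not_lt.1 (mt Finset.mem_range.2 hk)))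

lemma lintegral_spikeTransfer [BorelSpace X] (hv : IsSpikeSequence φ μ v) :
    ∫⁻ x, ENNReal.ofReal (spikeTransfer v x) ∂μ = ⊤ := by
  rw [← hv.tsum_lintegral_eq_top,
    ← lintegral_tsum fun k => (v k).continuous.measurable.ennreal_ofReal.aemeasurable]
  exact lintegral_congr_ae (hv.ae_summable.mono fun x hx =>
    ENNReal.ofReal_tsum_of_nonneg (fun k => hv.nonneg k x) hx)

lemma lintegral_exp_spikeTransfer [BorelSpace X] (hv : IsSpikeSequence φ μ v) {ε : ℝ}
    (hε : 0 < ε) : ∫⁻ x, ENNReal.ofReal (Real.exp (ε * spikeTransfer v x)) ∂μ = ⊤ := by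
  refine top_le_iff.1 ?_
  calc ⊤ = ENNReal.ofReal ε * ∫⁻ x, ENNReal.ofReal (spikeTransfer v x) ∂μ := by
        rw [hv.lintegral_spikeTransfer, ENNReal.mul_top (ENNReal.ofReal_pos.2 hε).ne']
    _ = ∫⁻ x, ENNReal.ofReal (ε * spikeTransfer v x) ∂μ := by
        rw [← lintegral_const_mul _ (measurable_spikeTransfer v).ennreal_ofReal]
        simp only [ENNReal.ofReal_mul hε.le]
    _ ≤ ∫⁻ x, ENNReal.ofReal (Real.exp (ε * spikeTransfer v x)) ∂μ :=
        lintegral_mono fun x => ENNReal.ofReal_le_ofReal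
          ((le_add_of_nonneg_right zero_le_one).trans (Real.add_one_le_exp _))

variable [CompactSpace X]

lemma hasSum_spikePotential (hv : IsSpikeSequence φ μ v) :
    HasSum (fun k => v k - (v k).comp (φ : C(X, X))) (spikePotential φ v) := by
  refine (Summable.of_norm_bounded summable_geometric_two fun k => ?_).hasSum
  exact (ContinuousMap.norm_le _ (by positivity)).2 fun x => hv.abs_sub_le k x

lemma hasSum_birkhoffSum (hv : IsSpikeSequence φ μ v) (n : ℕ) (x : X) :
    HasSum (fun k => v k x - v k (φ^[n] x)) (birkhoffSum φ (spikePotential φ v) n x) := by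
  refine (hasSum_sum fun j _ => ContinuousMap.hasSum_apply hv.hasSum_spikePotential
    (φ^[j] x)).congr_fun fun k => ?_
  simp only [ContinuousMap.sub_apply, ContinuousMap.comp_apply, ContinuousMap.coe_coe,
    ← Function.iterate_succ_apply']
  exact (Finset.sum_range_sub' (fun j => v k (φ^[j] x)) n).symm

lemma spikePotential_ae_eq (hv : IsSpikeSequence φ μ v) (hφ : MeasurePreserving φ μ μ) :
    spikePotential φ v =ᵐ[μ] spikeTransfer v - spikeTransfer v ∘ φ := by
  filter_upwards [hv.ae_summable, hφ.quasiMeasurePreserving.ae hv.ae_summable] with x hx hφx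
  exact (ContinuousMap.hasSum_apply hv.hasSum_spikePotential x).unique (hx.hasSum.sub hφx.hasSum)

theorem typeISet_eq_empty (hv : IsSpikeSequence φ μ v) (hper : Function.periodicPts φ = ∅)
    (β : ℝ) : typeISet φ (spikePotential φ v) β = ∅ := by
  obtain ⟨n, hn, hreturn⟩ := hv.exists_return
  refine eq_empty_of_forall_notMem fun x =>
    notMem_typeISet (C := 2) (hper ▸ notMem_empty x) hn.injective fun i => ?_
  rw [orbitSum_natCast]
  exact (hv.hasSum_birkhoffSum (n i) x).norm_le_of_bounded hasSum_geometric_two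
    fun k => hreturn i k x

variable [BorelSpace X]

theorem exists_isConformal [T2Space X] [HasOuterApproxClosed X] [IsProbabilityMeasure μ]
    (hv : IsSpikeSequence φ μ v) (hφ : MeasurePreserving φ μ μ) (β : ℝ) :
    ∃ m : Measure X, IsConformal φ (spikePotential φ v) β m := by
  refine (isClosed_setOf_exists_isConformal φ β).mem_of_tendsto
    hv.hasSum_spikePotential.tendsto_sum_nat (Eventually.of_forall fun N => ?_)
  have hcob : ⇑(∑ k ∈ Finset.range N, (v k - (v k).comp (φ : C(X, X)))) =
      ⇑(∑ k ∈ Finset.range N, v k) - ⇑(∑ k ∈ Finset.range N, v k) ∘ φ := by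
    ext x
    simp [Finset.sum_sub_distrib]
  refine ⟨_, isConformal_tilted hφ (EventuallyEq.of_eq hcob) ?_⟩
  exact Continuous.integrable_of_hasCompactSupport (by fun_prop)
    (HasCompactSupport.of_compactSpace _)

theorem existsUnique_isTypeIIOne [IsProbabilityMeasure μ] (hv : IsSpikeSequence φ μ v)
    (hφ : IsUniquelyErgodic φ μ) (hper : Function.periodicPts φ = ∅) (hβ : 0 ≤ β) :
    ∃! m : Measure X, IsConformal φ (spikePotential φ v) β m ∧ PreErgodic φ m ∧
      IsTypeIIOne φ (spikePotential φ v) β m :=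
  CrossedFlow.existsUnique_isTypeIIOne hφ (spikePotential φ v).continuous.measurable
    (measurable_spikeTransfer v) (hv.spikePotential_ae_eq hφ.measurePreserving)
    (integrable_exp_spikeTransfer hv.nonneg hβ)
    (by rw [hv.typeISet_eq_empty hper, measure_empty])

theorem isTypeIIInfty_or_isTypeIII (hv : IsSpikeSequence φ μ v)
    (hφ : IsUniquelyErgodic φ μ) (hper : Function.periodicPts φ = ∅) (hβ : β < 0) {m : Measure X}
    (hm : IsConformal φ (spikePotential φ v) β m) (herg : PreErgodic φ m) :
    IsTypeIIInfty φ (spikePotential φ v) β m ∨ IsTypeIII φ (spikePotential φ v) β m := by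
  have := hm.isProbabilityMeasure
  have hF : Measurable (spikePotential φ v) := (spikePotential φ v).continuous.measurable
  refine CrossedFlow.isTypeIIInfty_or_isTypeIII herg
    (by rw [hv.typeISet_eq_empty hper, measure_empty]) (hm.measure_typeIIOneSet_eq_zero herg hF ?_)
  exact hm.not_ae_lowerExpAverage_pos hφ hF (measurable_spikeTransfer v)
    (hv.spikePotential_ae_eq hφ.measurePreserving) hβ.le (spikeTransfer_nonneg hv.nonneg)
    (hv.lintegral_exp_spikeTransfer (neg_pos.2 hβ))

end IsSpikeSequence

end SpikeSequence

section ReturnTimes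

variable {G : Type*} [AddGroup G] [TopologicalSpace G] [IsTopologicalAddGroup G] [CompactSpace G]
  {U : ℕ → Set G}

lemma exists_lt_forall_le_mul_nsmul_mem (a : G) (hU : ∀ k, U k ∈ 𝓝 0) (N : ℕ) :
    ∃ n > N, ∀ k ≤ N, ∀ l ≤ N, (l * n) • a ∈ U k := by
  have hsmall : ∀ᶠ b in 𝓝 (0 : G), ∀ k ∈ Iic N, ∀ l ∈ Iic N, l • b ∈ U k := by
    simp only [eventually_all_finite (finite_Iic N)]
    exact fun k _ l _ => (continuous_nsmul l).tendsto' 0 0 (nsmul_zero l) (hU k)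
  obtain ⟨n, hn, hNn⟩ := (((mapClusterPt_zero_atTop_nsmul a).frequently hsmall).and_eventually
    (eventually_gt_atTop N)).exists
  exact ⟨n, hNn, fun k hk l hl => mul_nsmul' a l n ▸ hn k hk l hl⟩

/-- The times `q k` and `n i` are interlaced terms of a sequence in which each term returns so
closely that its multiples by all earlier terms do, too. -/
theorem exists_interlaced_return_times (a : G) (hU : ∀ k, U k ∈ 𝓝 0) :
    ∃ q n : ℕ → ℕ, (∀ k, q k ≠ 0) ∧ StrictMono n ∧ (∀ k, q k • a ∈ U k) ∧
      ∀ i k, (q k * n i) • a ∈ U k := by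
  obtain ⟨f, hpos, hf⟩ := exists_seq_of_forall_finset_exists (fun y : ℕ => 0 < y)
    (fun x y => x < y ∧ ∀ k ≤ x, ∀ l ≤ x, (l * y) • a ∈ U k) fun s _ => by
      obtain ⟨y, hy, hmem⟩ := exists_lt_forall_le_mul_nsmul_mem a hU (s.sup id)
      have hle : ∀ x ∈ s, x ≤ s.sup id := fun x hx => Finset.le_sup (f := id) hx
      exact ⟨y, by omega, fun x hx => ⟨(hle x hx).trans_lt hy,
        fun k hk l hl => hmem k (hk.trans (hle x hx)) l (hl.trans (hle x hx))⟩⟩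
  have hmono : StrictMono f := fun i j hij => (hf i j hij).1
  have hle : ∀ {i j}, i ≤ j → i ≤ f j := fun hij => hij.trans (hmono.id_le _)
  refine ⟨fun k => f (2 * k + 1), fun i => f (2 * i), fun k => (hpos _).ne',
    fun i j hij => hmono (by omega), fun k => ?_, fun i k => ?_⟩
  · simpa using (hf (2 * k) (2 * k + 1) (by omega)).2 k (hle (by omega)) 1 (hpos _)
  · rcases lt_or_ge k i with hki | hik
    · exact (hf (2 * k + 1) (2 * i) (by omega)).2 k (hle (by omega)) _ le_rfl
    · rw [mul_comm]
      exact (hf (2 * k) (2 * k + 1) (by omega)).2 k (hle (by omega)) _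
        (hmono.monotone (by omega))

end ReturnTimes

section Circle

/-- The tent of height `2 ^ k` over the ball of radius `2⁻ᵏ` about `0`: the heights compensate for
the radii, so that the integrals stay away from `0` while the measures of the supports are
summable. -/
noncomputable def tent (k : ℕ) : C(UnitAddCircle, ℝ) where
  toFun x := max 0 (2 ^ k - 4 ^ k * ‖x‖)

lemma tent_apply (k : ℕ) (x : UnitAddCircle) : tent k x = max 0 (2 ^ k - 4 ^ k * ‖x‖) :=
  rfl

lemma abs_tent_sub_tent_le (k : ℕ) (x y : UnitAddCircle) :
    |tent k x - tent k y| ≤ 4 ^ k * ‖x - y‖ := by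
  calc |tent k x - tent k y| ≤ |(2 ^ k - 4 ^ k * ‖x‖) - (2 ^ k - 4 ^ k * ‖y‖)| := by
        rw [tent_apply, tent_apply, max_comm 0, max_comm 0]
        exact abs_max_sub_max_le_abs _ _ _
    _ = 4 ^ k * |‖y‖ - ‖x‖| := by
        rw [sub_sub_sub_cancel_left, ← mul_sub, abs_mul, abs_of_pos (by positivity)]
    _ ≤ 4 ^ k * ‖x - y‖ := by
        rw [norm_sub_rev]
        gcongr
        exact abs_norm_sub_norm_le y x

lemma volume_support_tent_le (k : ℕ) :
    volume (Function.support (tent k)) ≤ ENNReal.ofReal (2 * (1 / 2) ^ k) := by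
  have hsub : Function.support (tent k) ⊆ Metric.closedBall 0 ((1 / 2) ^ k) := fun x hx => by
    rw [mem_closedBall_zero_iff]
    by_contra! hlt
    refine hx (max_eq_left (sub_nonpos.2 ?_))
    calc (2 : ℝ) ^ k = 4 ^ k * (1 / 2) ^ k := by rw [← mul_pow]; norm_num
      _ ≤ 4 ^ k * ‖x‖ := by gcongr
  refine (measure_mono hsub).trans ?_
  rw [AddCircle.volume_closedBall]
  exact ENNReal.ofReal_le_ofReal (min_le_right _ _)

lemma half_le_lintegral_tent (k : ℕ) :
    ENNReal.ofReal (1 / 2) ≤ ∫⁻ x, ENNReal.ofReal (tent k x) := by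
  have htent : ∀ x ∈ Metric.closedBall (0 : UnitAddCircle) ((1 / 2) ^ k / 2),
      2 ^ k / 2 ≤ tent k x := fun x hx => by
    refine le_max_of_le_right ?_
    calc (2 : ℝ) ^ k / 2 = 2 ^ k - 4 ^ k * ((1 / 2) ^ k / 2) := by
          rw [← mul_div_assoc, ← mul_pow]
          norm_num
          ring
      _ ≤ 2 ^ k - 4 ^ k * ‖x‖ := by
          gcongr
          exact mem_closedBall_zero_iff.1 hx
  calc ENNReal.ofReal (1 / 2)
      = ENNReal.ofReal (2 ^ k / 2) * volume (Metric.closedBall (0 : UnitAddCircle)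
          ((1 / 2) ^ k / 2)) := by
        rw [AddCircle.volume_closedBall, mul_div_cancel₀ _ two_ne_zero,
          min_eq_right (pow_le_one₀ (by norm_num) (by norm_num)),
          ← ENNReal.ofReal_mul (by positivity), div_mul_eq_mul_div, ← mul_pow]
        norm_num
    _ = ∫⁻ _ in Metric.closedBall (0 : UnitAddCircle) ((1 / 2) ^ k / 2),
          ENNReal.ofReal (2 ^ k / 2) := (setLIntegral_const _ _).symm
    _ ≤ ∫⁻ x in Metric.closedBall 0 ((1 / 2) ^ k / 2), ENNReal.ofReal (tent k x) :=
        setLIntegral_mono' Metric.isClosed_closedBall.measurableSet fun x hx =>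
          ENNReal.ofReal_le_ofReal (htent x hx)
    _ ≤ ∫⁻ x, ENNReal.ofReal (tent k x) := setLIntegral_le_lintegral _ _

/-- The tent function repeated periodically `q` times around the circle: multiplication by `q`
preserves integrals, and makes every translation by some `b` with `q • b` small a near symmetry. -/
noncomputable def repeatedTent (q k : ℕ) : C(UnitAddCircle, ℝ) :=
  (tent k).comp ⟨fun x => q • x, by fun_prop⟩

lemma abs_repeatedTent_sub_le {q k : ℕ} {b : UnitAddCircle}
    (hb : q • b ∈ Metric.closedBall 0 ((1 / 8) ^ k)) (x : UnitAddCircle) :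
    |repeatedTent q k x - repeatedTent q k (b + x)| ≤ (1 / 2) ^ k := by
  calc |repeatedTent q k x - repeatedTent q k (b + x)| ≤ 4 ^ k * ‖q • b‖ := by
        refine (abs_tent_sub_tent_le k (q • x) (q • (b + x))).trans_eq ?_
        rw [smul_add, sub_add_cancel_right, norm_neg]
    _ ≤ 4 ^ k * (1 / 8) ^ k := by
        gcongr
        exact mem_closedBall_zero_iff.1 hb
    _ = (1 / 2) ^ k := by
        rw [← mul_pow]
        norm_num

lemma measurePreserving_nsmul {q : ℕ} (hq : q ≠ 0) :
    MeasurePreserving (fun x : UnitAddCircle => q • x) volume volume := by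
  simpa only [natCast_zsmul] using
    Measure.measurePreserving_zsmul (volume : Measure UnitAddCircle) (Nat.cast_ne_zero.2 hq)

lemma volume_support_repeatedTent_le {q : ℕ} (hq : q ≠ 0) (k : ℕ) :
    volume (Function.support (repeatedTent q k)) ≤ ENNReal.ofReal (2 * (1 / 2) ^ k) := by
  have hopen : IsOpen (Function.support (tent k)) := (tent k).continuous.isOpen_support
  have hpreimage : Function.support (repeatedTent q k) =
      (fun x => q • x) ⁻¹' Function.support (tent k) := rfl
  rw [hpreimage,
    (measurePreserving_nsmul hq).measure_preimage hopen.measurableSet.nullMeasurableSet]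
  exact volume_support_tent_le k

lemma half_le_lintegral_repeatedTent {q : ℕ} (hq : q ≠ 0) (k : ℕ) :
    ENNReal.ofReal (1 / 2) ≤ ∫⁻ x, ENNReal.ofReal (repeatedTent q k x) := by
  refine (half_le_lintegral_tent k).trans_eq ?_
  exact ((measurePreserving_nsmul hq).lintegral_comp
    (tent k).continuous.measurable.ennreal_ofReal).symm

theorem exists_isSpikeSequence (a : UnitAddCircle) :
    ∃ v : ℕ → C(UnitAddCircle, ℝ), IsSpikeSequence (Homeomorph.addLeft a) volume v := by
  obtain ⟨q, n, hq, hn, hqa, hqna⟩ := exists_interlaced_return_times a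
    (U := fun k => Metric.closedBall 0 ((1 / 8) ^ k))
    fun k => Metric.closedBall_mem_nhds 0 (by positivity)
  refine ⟨fun k => repeatedTent (q k) k, fun k x => le_max_left _ _,
    fun k x => abs_repeatedTent_sub_le (hqa k) x, ⟨n, hn, fun i k x => ?_⟩, ?_, ?_⟩
  · rw [Homeomorph.coe_addLeft, add_left_iterate]
    exact abs_repeatedTent_sub_le (by simpa only [← mul_nsmul'] using hqna i k) x
  · exact ne_top_of_le_ne_top (Summable.tsum_ofReal_ne_top (summable_geometric_two.mul_left 2))
      (ENNReal.tsum_le_tsum fun k => volume_support_repeatedTent_le (hq k) k)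
  · refine top_le_iff.1 (Eq.trans_le ?_
      (ENNReal.tsum_le_tsum fun k => half_le_lintegral_repeatedTent (hq k) k))
    exact (ENNReal.tsum_const_eq_top_of_ne_zero (by norm_num)).symm

end Circle

end CrossedFlow

theorem proposition7p3 (α : ℝ) (hα : Irrational α)
    (φ : UnitAddCircle ≃ₜ UnitAddCircle) (hφ : ∀ x, φ x = x + (α : UnitAddCircle)) :
    ∃ F : UnitAddCircle → ℝ, Continuous F ∧
      (∀ β : ℝ, ∃ m : Measure UnitAddCircle, CrossedFlow.IsConformal φ F β m) ∧
      (∀ β : ℝ, 0 ≤ β → ∃! m : Measure UnitAddCircle,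
        CrossedFlow.IsConformal φ F β m ∧ PreErgodic φ m ∧ CrossedFlow.IsTypeIIOne φ F β m) ∧
      (∀ β : ℝ, β < 0 → ∀ m : Measure UnitAddCircle,
        CrossedFlow.IsConformal φ F β m → PreErgodic φ m →
          CrossedFlow.IsTypeIIInfty φ F β m ∨ CrossedFlow.IsTypeIII φ F β m) := by
  obtain rfl : φ = Homeomorph.addLeft (α : UnitAddCircle) :=
    Homeomorph.ext fun x => (hφ x).trans (add_comm _ _)
  have hdense : DenseRange fun n : ℤ => n • (α : UnitAddCircle) :=
    AddCircle.denseRange_zsmul_coe_iff.2 (by simpa using hα)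
  have : IsProbabilityMeasure (volume : Measure UnitAddCircle) := ⟨UnitAddCircle.measure_univ⟩
  have hue := CrossedFlow.isUniquelyErgodic_add_left (volume : Measure UnitAddCircle) hdense
  have hper : Function.periodicPts (Homeomorph.addLeft (α : UnitAddCircle)) = ∅ := by
    refine eq_empty_of_forall_notMem fun x ⟨n, hn, hx⟩ => ?_
    rw [Homeomorph.coe_addLeft, Function.IsPeriodicPt, add_left_iterate] at hx
    exact addOrderOf_eq_zero_iff'.1 (AddCircle.denseRange_zsmul_iff.1 hdense) n hn
      (add_eq_right.1 hx)
  obtain ⟨v, hv⟩ := CrossedFlow.exists_isSpikeSequence (α : UnitAddCircle)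
  exact ⟨CrossedFlow.spikePotential _ v, map_continuous _,
    hv.exists_isConformal hue.measurePreserving,
    fun β hβ => hv.existsUnique_isTypeIIOne hue hper hβ,
    fun β hβ m hm herg => hv.isTypeIIInfty_or_isTypeIII hue hper hβ hm herg⟩
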